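/- Let $\alpha_1,\alpha_2,\alpha_3,\alpha_4>1$ and $\alpha_{21}$ be integers with $0<\alpha_{21}<\alpha_1-1$, and let $$\begin{aligned} n_1&=\alpha_2\alpha_3(\alpha_4-1)+1,\\ n_2&=\alpha_{21}\alpha_3\alpha_4+(\alpha_1-\alpha_{21}-1)(\alpha_3-1)+\alpha_3,\\ n_3&=\alpha_1\alpha_4+(\alpha_1-\alpha_{21}-1)(\alpha_2-1)(\alpha_4-1)-\alpha_4+1,\\ n_4&=\alpha_1\alpha_2(\alpha_3-1)+\alpha_{21}(\alpha_2-1)+\alpha_2, \end{aligned}$$ with $\gcd(n_1,n_2,n_3,n_4)=1$; the numerical semigroups $S=\langle n_1,n_2,n_3,n_4\rangle$ of this form are, by a theorem of Komeda, the $4$-generated pseudo-symmetric ones (up to the order of the generators). Assume that $\alpha_4=3$, that $n_1<n_2<n_3<n_4$ and that $\alpha_2>\alpha_{21}+1$. Let $K$ be a field and let $I_S\subset K[X_1,X_2,X_3,X_4]$ be the toric ideal of $S$, that is, the kernel of the $K$-algebra homomorphism $X_i\mapsto t^{n_i}$ to $K[t]$. Let $s$ and $l$ be the smallest non-negative integers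 with $$s\alpha_1+(2s+2)\alpha_{21}+\alpha_3>(2s+1)\alpha_2+(s+2),\qquad l\alpha_1+(2l+3)\alpha_{21}+\alpha_3>(2l+2)\alpha_2+(l+1).$$ Put $$\begin{aligned} f_1&=X_1^{\alpha_1}-X_3X_4^{\alpha_4-1}, & f_2&=X_2^{\alpha_2}-X_1^{\alpha_{21}}X_4, & f_3&=X_3^{\alpha_3}-X_1^{\alpha_1-\alpha_{21}-1}X_2,\\ f_4&=X_4^{\alpha_4}-X_1X_2^{\alpha_2-1}X_3^{\alpha_3-1}, & f_5&=X_1^{\alpha_{21}+1}X_3^{\alpha_3-1}-X_2X_4^{\alpha_4-1}, & f_6&=X_1^{\alpha_1+\alpha_{21}}-X_2^{\alpha_2}X_3X_4,\\ f_7&=X_1^{\alpha_1+2\alpha_{21}}-X_2^{2\alpha_2}X_3, \end{aligned}$$ $$g_i=X_2^{(2i+1)\alpha_2+1}X_4-X_1^{i\alpha_1+(2i+2)\alpha_{21}+1}X_3^{\alpha_3-(i+1)},\qquad h_j=X_2^{(2j+2)\alpha_2+1}-X_1^{j\alpha_1+(2j+3)\alpha_{21}+1}X_3^{\alpha_3-(j+1)}.$$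 Let $>$ be any negative-degree (local) monomial ordering, i.e. a total ordering of the monomials, compatible with multiplication, in which a monomial of smaller total degree is larger; whenever the two monomials of some $g_i$ with $i<s$ have the same total degree, assume that $>$ makes $X_1^{i\alpha_1+(2i+2)\alpha_{21}+1}X_3^{\alpha_3-(i+1)}$ the larger of the two. (This last condition holds, for instance, for the negative degree reverse lexicographic and the negative degree lexicographic orderings with $X_1>X_2>X_3>X_4$.) Then $$G=\{f_1,f_2,f_3,f_4,f_5,f_6,f_7,\;g_0,g_1,\dots,g_s,\;h_s,h_{s+1},\dots,h_l\}$$ is a standard basis of $I_S$ with respect to $>$: $G\subset I_S$, and the leading monomials of the elements of $G$ generate the leading ideal of $I_S\,K[X_1,X_2,X_3,X_4]_{\langle X_1,X_2,X_3,X_4\rangle}$. -/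

import Mathlib

open MvPolynomial

/-- The parametrisation of 4-generated pseudo-symmetric numerical semigroups: `n` lists the
generators `n₁, n₂, n₃, n₄` (as `n 0, n 1, n 2, n 3`), expressed by integers
`α₁, α₂, α₃, α₄ > 1` and `0 < α₂₁ < α₁ - 1`. Under these bounds no subtraction below truncates. -/
structure IsPseudoSymmetricData (n : Fin 4 → ℕ) (α₁ α₂ α₃ α₄ α₂₁ : ℕ) : Prop where
  one_lt_α₁ : 1 < α₁
  one_lt_α₂ : 1 < α₂
  one_lt_α₃ : 1 < α₃
  one_lt_α₄ : 1 < α₄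
  α₂₁_pos : 0 < α₂₁
  α₂₁_lt : α₂₁ < α₁ - 1
  n₁_eq : n 0 = α₂ * α₃ * (α₄ - 1) + 1
  n₂_eq : n 1 = α₂₁ * α₃ * α₄ + (α₁ - α₂₁ - 1) * (α₃ - 1) + α₃
  n₃_eq : n 2 = α₁ * α₄ + (α₁ - α₂₁ - 1) * (α₂ - 1) * (α₄ - 1) - α₄ + 1
  n₄_eq : n 3 = α₁ * α₂ * (α₃ - 1) + α₂₁ * (α₂ - 1) + α₂

noncomputable section

/-- The toric ideal `I_S ⊆ K[X₁, X₂, X₃, X₄]` of `S = ⟨n₁, n₂, n₃, n₄⟩`: the kernel of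
`φ : X_i ↦ t ^ n_i`. -/
def toricIdeal (K : Type*) [Field K] (n : Fin 4 → ℕ) : Ideal (MvPolynomial (Fin 4) K) :=
  RingHom.ker (aeval (fun i => (Polynomial.X : Polynomial K) ^ n i) :
    MvPolynomial (Fin 4) K →ₐ[K] Polynomial K)

/-- `lt a b` means `X ^ a < X ^ b`. The relation is a monomial ordering that is local and compares
negative degrees first: the monomial of smaller total degree is the larger one. -/
structure IsNegDegreeOrdering (lt : (Fin 4 →₀ ℕ) → (Fin 4 →₀ ℕ) → Prop) : Prop where
  irrefl : ∀ a, ¬ lt a a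
  trans : ∀ a b c, lt a b → lt b c → lt a c
  total : ∀ a b, lt a b ∨ a = b ∨ lt b a
  add_right : ∀ a b c, lt a b → lt (a + c) (b + c)
  of_degree_lt : ∀ a b, b.degree < a.degree → lt a b

/-- `m` is the exponent of the leading monomial of `f` (there is none if `f = 0`). -/
def IsLeadingExponent {K : Type*} [Field K] (lt : (Fin 4 →₀ ℕ) → (Fin 4 →₀ ℕ) → Prop)
    (f : MvPolynomial (Fin 4) K) (m : Fin 4 →₀ ℕ) : Prop :=
  m ∈ f.support ∧ ∀ m' ∈ f.support, m' ≠ m → lt m' m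

/-- The leading ideal `L(T)`, generated by the leading monomials of the nonzero elements of `T`. -/
def leadingIdeal {K : Type*} [Field K] (lt : (Fin 4 →₀ ℕ) → (Fin 4 →₀ ℕ) → Prop)
    (T : Set (MvPolynomial (Fin 4) K)) : Ideal (MvPolynomial (Fin 4) K) :=
  Ideal.span {p | ∃ f ∈ T, ∃ m, IsLeadingExponent lt f m ∧ p = monomial m 1}

/-- The polynomials with nonzero constant term; for a local ordering these are the polynomials with
leading monomial `1`, and inverting them gives the ring `K[X]_>` attached to the ordering. -/
def nonvanishingAtOrigin (K : Type*) [Field K] : Submonoid (MvPolynomial (Fin 4) K) :=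
  (nonZeroDivisors K).comap (constantCoeff : MvPolynomial (Fin 4) K →+* K)

/-- The polynomials lying in the extension of `I` to the local ring `K[X]_⟨X⟩`. -/
def localClosure {K : Type*} [Field K] (I : Ideal (MvPolynomial (Fin 4) K)) :
    Ideal (MvPolynomial (Fin 4) K) :=
  (I.map (algebraMap (MvPolynomial (Fin 4) K) (Localization (nonvanishingAtOrigin K)))).comap
    (algebraMap (MvPolynomial (Fin 4) K) (Localization (nonvanishingAtOrigin K)))

/-- `G` is a standard basis of `I` for a local ordering: a finite subset of `I` whose leading
monomials generate the leading ideal of `I K[X]_⟨X⟩`. Multiplying by a polynomial with nonzero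
constant term does not affect leading monomials up to scalars, so it suffices to take the leading
monomials of the polynomials in `I K[X]_⟨X⟩`. -/
def IsStandardBasis {K : Type*} [Field K] (lt : (Fin 4 →₀ ℕ) → (Fin 4 →₀ ℕ) → Prop)
    (I : Ideal (MvPolynomial (Fin 4) K)) (G : Set (MvPolynomial (Fin 4) K)) : Prop :=
  G.Finite ∧ G ⊆ (I : Set (MvPolynomial (Fin 4) K)) ∧
    leadingIdeal lt G = leadingIdeal lt (localClosure I : Set (MvPolynomial (Fin 4) K))

/-- The exponent of `X₁ ^ a * X₂ ^ b * X₃ ^ c * X₄ ^ d`. -/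
def expo (a b c d : ℕ) : Fin 4 →₀ ℕ := Finsupp.equivFunOnFinite.symm ![a, b, c, d]

/-- `X₁ ^ a * X₂ ^ b * X₃ ^ c * X₄ ^ d`. -/
def mon (K : Type*) [Field K] (a b c d : ℕ) : MvPolynomial (Fin 4) K :=
  X 0 ^ a * X 1 ^ b * X 2 ^ c * X 3 ^ d

/-- `g_i = X₂^((2i+1)α₂+1) X₄ - X₁^(iα₁+(2i+2)α₂₁+1) X₃^(α₃-(i+1))`. -/
def gBinomial (K : Type*) [Field K] (α₁ α₂ α₃ α₂₁ i : ℕ) : MvPolynomial (Fin 4) K :=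
  mon K 0 ((2 * i + 1) * α₂ + 1) 0 1
    - mon K (i * α₁ + (2 * i + 2) * α₂₁ + 1) 0 (α₃ - (i + 1)) 0

/-- `h_j = X₂^((2j+2)α₂+1) - X₁^(jα₁+(2j+3)α₂₁+1) X₃^(α₃-(j+1))`. -/
def hBinomial (K : Type*) [Field K] (α₁ α₂ α₃ α₂₁ j : ℕ) : MvPolynomial (Fin 4) K :=
  mon K 0 ((2 * j + 2) * α₂ + 1) 0 0
    - mon K (j * α₁ + (2 * j + 3) * α₂₁ + 1) 0 (α₃ - (j + 1)) 0

/-- `{f₁, …, f₇, g₀, …, g_s, h_s, …, h_l}`, where `f₁, …, f₅` are written for general `α₄` and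
`f₆, f₇, g_i, h_j` are the additional binomials for `α₄ = 3`. -/
def basisSet (K : Type*) [Field K] (α₁ α₂ α₃ α₄ α₂₁ s l : ℕ) : Set (MvPolynomial (Fin 4) K) :=
  {mon K α₁ 0 0 0 - mon K 0 0 1 (α₄ - 1),
   mon K 0 α₂ 0 0 - mon K α₂₁ 0 0 1,
   mon K 0 0 α₃ 0 - mon K (α₁ - α₂₁ - 1) 1 0 0,
   mon K 0 0 0 α₄ - mon K 1 (α₂ - 1) (α₃ - 1) 0,
   mon K (α₂₁ + 1) 0 (α₃ - 1) 0 - mon K 0 1 0 (α₄ - 1),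
   mon K (α₁ + α₂₁) 0 0 0 - mon K 0 α₂ 1 1,
   mon K (α₁ + 2 * α₂₁) 0 0 0 - mon K 0 (2 * α₂) 1 0}
  ∪ gBinomial K α₁ α₂ α₃ α₂₁ '' Set.Iic s
  ∪ hBinomial K α₁ α₂ α₃ α₂₁ '' Set.Icc s l

end

/-! The toric ideal is prime and lies in the maximal ideal of the origin, so it is contracted from
the local ring. Modulo it, monomials of equal weight `∑ nᵢ mᵢ` coincide. So it suffices that each
weight contains at most one exponent divisible by no leading monomial of `G`
(`isStandardBasis_of_unique`); no S-polynomial is reduced.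

For two such exponents `p`, `q` of equal weight, `p - q` lies in the rank 3 lattice of relations
between the `nᵢ`, with basis the exponent vectors of `f₇`, `f₂`, `f₃` and coordinates `x`, `v₄ = p₄
- q₄`, `z`. In these coordinates `g_i` is `(-(i+1), 1, -1)` and `h_j` is `(-(j+1), 0, -1)`. The
leading monomials force `v₄ = 0`, then `z = 0`, then `x = 0` (`staircase_unique`). The order of the
generators determines which monomial of each `fᵢ` leads, except for `f₂`, where `α₂₁ + 1 < α₂` does.
-/

/-! ### The lattice of relations between the generators. -/

/-- The syzygy lattice of `(N₁, N₂, N₃, N₄)` is spanned by the three vectors read off from the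
relations `R₁`, `R₂`, `R₃`; eliminating one coefficient leaves `x`, `z` and `v₄` as coordinates. -/
lemma exists_coordinates_of_weight_eq_zero {A₁ A₂ A₃ a N₁ N₂ N₃ N₄ v₁ v₂ v₃ v₄ : ℤ}
    (hN₁ : N₁ = 2 * A₂ * A₃ + 1) (hpos : 0 < N₁)
    (R₁ : A₁ * N₁ = N₃ + 2 * N₄) (R₂ : A₂ * N₂ = a * N₁ + N₄)
    (R₃ : A₃ * N₃ = (A₁ - a - 1) * N₁ + N₂) (hcop : IsCoprime N₁ N₃)
    (hv : N₁ * v₁ + N₂ * v₂ + N₃ * v₃ + N₄ * v₄ = 0) :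
    ∃ x z : ℤ, v₁ = (A₁ + 2 * a) * x + a * v₄ - (A₁ - a - 1) * z ∧
      v₂ = -2 * A₂ * x - A₂ * v₄ - z ∧ v₃ = -x + A₃ * z := by
  have hN₂ : N₂ = A₃ * N₃ - (A₁ - a - 1) * N₁ := by linarith
  have hN₄ : N₄ = A₂ * N₂ - a * N₁ := by linarith
  -- Modulo `N₁` the relations give `N₂ ≡ A₃ N₃` and `N₄ ≡ A₂ A₃ N₃`, so the weight is `N₃` times
  -- this expression.
  have hdvd : N₁ ∣ v₃ + A₃ * v₂ + A₂ * A₃ * v₄ := by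
    refine hcop.dvd_of_dvd_mul_left
      ⟨-v₁ + (A₁ - a - 1) * v₂ + (A₂ * (A₁ - a - 1) + a) * v₄, ?_⟩
    rw [hN₄, hN₂] at hv
    linear_combination hv
  obtain ⟨y, hy⟩ := hdvd
  have h₂ : v₂ = -2 * A₂ * (-y) - A₂ * v₄ - (2 * A₂ * y - A₂ * v₄ - v₂) := by ring
  have h₃ : v₃ = -(-y) + A₃ * (2 * A₂ * y - A₂ * v₄ - v₂) := by
    rw [hN₁] at hy
    linear_combination hy
  refine ⟨-y, 2 * A₂ * y - A₂ * v₄ - v₂, ?_, h₂, h₃⟩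
  generalize 2 * A₂ * y - A₂ * v₄ - v₂ = z at h₂ h₃
  refine mul_left_cancel₀ hpos.ne' ?_
  rw [h₂, h₃] at hv
  linear_combination hv + y * R₁ + (v₄ - 2 * y) * R₂ - z * R₃

/-! ### Uniqueness of staircase points in each weight. -/

/-- The exponents `p` that are divisible by none of the listed leading exponents of
`f₁, …, f₇, g₀, …, g_s, h_l`. -/
structure IsStaircasePoint (A₁ A₂ A₃ a s l p₁ p₂ p₃ p₄ : ℤ) : Prop where
  nonneg : 0 ≤ p₁ ∧ 0 ≤ p₂ ∧ 0 ≤ p₃ ∧ 0 ≤ p₄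
  f₁ : ¬ (1 ≤ p₃ ∧ 2 ≤ p₄)
  f₂ : ¬ (a ≤ p₁ ∧ 1 ≤ p₄)
  f₃ : ¬ A₃ ≤ p₃
  f₄ : ¬ 3 ≤ p₄
  f₅ : ¬ (1 ≤ p₂ ∧ 2 ≤ p₄)
  f₆ : ¬ (A₂ ≤ p₂ ∧ 1 ≤ p₃ ∧ 1 ≤ p₄)
  f₇ : ¬ (2 * A₂ ≤ p₂ ∧ 1 ≤ p₃)
  g_lt : ∀ i : ℤ, 0 ≤ i → i < s →
    ¬ (i * A₁ + (2 * i + 2) * a + 1 ≤ p₁ ∧ A₃ - (i + 1) ≤ p₃)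
  g_last : ¬ ((2 * s + 1) * A₂ + 1 ≤ p₂ ∧ 1 ≤ p₄)
  h_last : ¬ (2 * l + 2) * A₂ + 1 ≤ p₂

section Staircase

variable {A₁ A₂ A₃ a s l p₁ p₂ p₃ p₄ q₁ q₂ q₃ q₄ x z : ℤ}

lemma eq_neg_one_of_lt {A₃ x z : ℤ} (hz : z < 0) (h₃ : x - A₃ * z < A₃) (hx : -A₃ < x)
    (hA₃ : 0 < A₃) : z = -1 := by
  by_contra h
  have : z ≤ -2 := by omega
  nlinarith

/-- Here `p₄ ≥ 2`, so `f₁`, `f₅`, `f₂` give `p₃ = p₂ = 0` and `p₁ < a`. If `z ≥ 0` then `x ≥ z`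
makes `p₁` at least `2a`; if `z < 0` then `x < 0` makes `p₂` positive. -/
lemma staircase_ne_two (hA₂ : 1 < A₂) (hA₃ : 1 < A₃) (ha : 0 < a) (hA₁ : a < A₁ - 1)
    (hp : IsStaircasePoint A₁ A₂ A₃ a s l p₁ p₂ p₃ p₄)
    (hq : IsStaircasePoint A₁ A₂ A₃ a s l q₁ q₂ q₃ q₄)
    (h₁ : p₁ - q₁ = (A₁ + 2 * a) * x + a * (p₄ - q₄) - (A₁ - a - 1) * z)
    (h₂ : p₂ - q₂ = -2 * A₂ * x - A₂ * (p₄ - q₄) - z)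
    (h₃ : p₃ - q₃ = -x + A₃ * z) : p₄ - q₄ ≠ 2 := by
  intro h₄
  rw [h₄] at h₁ h₂
  obtain ⟨p1, p2, p3, p4⟩ := hp.nonneg
  obtain ⟨q1, q2, q3, q4⟩ := hq.nonneg
  have e1 := hp.f₁
  have e2 := hp.f₂
  have e3 := hq.f₃
  have e5 := hp.f₅
  have hp2 : p₂ = 0 := by omega
  have hp3 : p₃ = 0 := by omega
  have hp1 : p₁ < a := by omega
  rcases le_or_gt 0 z with hz | hz
  · have hx : z ≤ x := by nlinarith
    nlinarith [mul_le_mul_of_nonneg_left hx (by omega : 0 ≤ A₁ + 2 * a), mul_nonneg ha.le hz]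
  · have hx : x ≤ -1 := by nlinarith
    nlinarith

/-- For `z ≥ 0` the monomials of `f₂`, `f₃`, `f₆` suffice. For `z < 0`, `g_s` bounds `x` below,
which forces `z = -1`; then `p - q` is the exponent vector of `g_i` with `i = -x - 1 < s`, whose
leading monomial divides `q`. -/
lemma staircase_ne_one (hA₂ : 1 < A₂) (hA₃ : 1 < A₃) (ha : 0 < a) (hA₁ : a < A₁ - 1)
    (hsA : s < A₃)
    (hp : IsStaircasePoint A₁ A₂ A₃ a s l p₁ p₂ p₃ p₄)
    (hq : IsStaircasePoint A₁ A₂ A₃ a s l q₁ q₂ q₃ q₄)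
    (h₁ : p₁ - q₁ = (A₁ + 2 * a) * x + a * (p₄ - q₄) - (A₁ - a - 1) * z)
    (h₂ : p₂ - q₂ = -2 * A₂ * x - A₂ * (p₄ - q₄) - z)
    (h₃ : p₃ - q₃ = -x + A₃ * z) : p₄ - q₄ ≠ 1 := by
  intro h₄
  rw [h₄] at h₁ h₂
  obtain ⟨p1, p2, p3, p4⟩ := hp.nonneg
  obtain ⟨q1, q2, q3, q4⟩ := hq.nonneg
  have e2 := hp.f₂
  have e3 := hp.f₃
  have e3' := hq.f₃
  have e6 := hp.f₆
  have eg := hp.g_last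
  have hp1 : p₁ < a := by omega
  rcases le_or_gt 0 z with hz | hz
  · rcases le_or_gt 0 x with hx | hx
    · have hxz : x < z := by
        by_contra! h
        nlinarith [mul_le_mul_of_nonneg_left h (by omega : 0 ≤ A₁ + 2 * a), mul_nonneg ha.le hz]
      have hz1 : z < 2 := by
        by_contra! h
        nlinarith
      have hz' : z = 1 := by omega
      subst hz'
      omega
    · have hz' : z = 0 := by
        by_contra h
        have : 1 ≤ z := by omega
        nlinarith
      subst hz'
      exact e6 ⟨by nlinarith, by linarith, by omega⟩
  · have hx : x ≤ -1 := by nlinarith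
    have hp2 : A₂ ≤ p₂ := by nlinarith
    have hp3 : p₃ = 0 := by omega
    have hk : -s ≤ x := by
      by_contra! h
      exact eg ⟨by nlinarith, by omega⟩
    obtain rfl : z = -1 := eq_neg_one_of_lt (A₃ := A₃) (x := x) hz (by linarith) (by omega) (by omega)
    refine hq.g_lt (-x - 1) (by omega) (by omega) ⟨?_, by linarith⟩
    nlinarith

/-- With `p₄ = q₄` and `z < 0`, `h_l` bounds `x` below and again `z = -1`, so `p - q` is the
exponent vector of `h_j` with `j = -x - 1 < l`. -/
lemma staircase_not_neg (hA₂ : 1 < A₂) (hA₃ : 1 < A₃) (ha : 0 < a) (hlA : l < A₃)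
    (hp : IsStaircasePoint A₁ A₂ A₃ a s l p₁ p₂ p₃ p₄)
    (hq : IsStaircasePoint A₁ A₂ A₃ a s l q₁ q₂ q₃ q₄)
    (hpq : ∀ j : ℤ, 0 ≤ j → s ≤ j → j < l → ¬ ((2 * j + 2) * A₂ + 1 ≤ p₂ ∧
      j * A₁ + (2 * j + 3) * a + 1 ≤ q₁ ∧ A₃ - (j + 1) ≤ q₃))
    (h₁ : p₁ - q₁ = (A₁ + 2 * a) * x - (A₁ - a - 1) * z)
    (h₂ : p₂ - q₂ = -2 * A₂ * x - z)
    (h₃ : p₃ - q₃ = -x + A₃ * z) : 0 ≤ z := by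
  by_contra! hz
  obtain ⟨p1, p2, p3, p4⟩ := hp.nonneg
  obtain ⟨q1, q2, q3, q4⟩ := hq.nonneg
  have e3' := hq.f₃
  have e7 := hp.f₇
  have eh := hp.h_last
  have hx : x ≤ -1 := by nlinarith
  have hp2 : 2 * A₂ ≤ p₂ := by nlinarith
  have hp3 : p₃ = 0 := by omega
  have hk : -l ≤ x := by
    by_contra! h
    exact eh (by nlinarith)
  obtain rfl : z = -1 := eq_neg_one_of_lt (A₃ := A₃) (x := x) hz (by linarith) (by omega) (by omega)
  have hq1 : (-x - 1) * A₁ + (2 * (-x - 1) + 3) * a + 1 ≤ q₁ := by nlinarith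
  -- For `j < s` the leading monomial of `g_j` divides the `X₁`, `X₃` monomial of `h_j`, so only
  -- `h_j` with `j ≥ s` are needed.
  rcases lt_or_ge (-x - 1) s with hs | hs
  · exact hq.g_lt (-x - 1) (by omega) hs ⟨by nlinarith, by linarith⟩
  · exact hpq (-x - 1) (by omega) hs (by omega) ⟨by nlinarith, hq1, by linarith⟩

lemma staircase_coord_nonneg (hA₂ : 1 < A₂)
    (hp : IsStaircasePoint A₁ A₂ A₃ a s l p₁ p₂ p₃ p₄)
    (hq : IsStaircasePoint A₁ A₂ A₃ a s l q₁ q₂ q₃ q₄)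
    (h₂ : p₂ - q₂ = -2 * A₂ * x) (h₃ : p₃ - q₃ = -x) : 0 ≤ x := by
  by_contra! hx
  obtain ⟨q1, q2, q3, q4⟩ := hq.nonneg
  exact hp.f₇ ⟨by nlinarith, by omega⟩

/-- Two points of the staircase with the same weight coincide. -/
lemma staircase_unique {N₁ N₂ N₃ N₄ : ℤ}
    (hA₂ : 1 < A₂) (hA₃ : 1 < A₃) (ha : 0 < a) (hA₁ : a < A₁ - 1)
    (hsA : s < A₃) (hlA : l < A₃)
    (hN₁ : N₁ = 2 * A₂ * A₃ + 1)
    (R₁ : A₁ * N₁ = N₃ + 2 * N₄) (R₂ : A₂ * N₂ = a * N₁ + N₄)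
    (R₃ : A₃ * N₃ = (A₁ - a - 1) * N₁ + N₂) (hcop : IsCoprime N₁ N₃)
    (hp : IsStaircasePoint A₁ A₂ A₃ a s l p₁ p₂ p₃ p₄)
    (hq : IsStaircasePoint A₁ A₂ A₃ a s l q₁ q₂ q₃ q₄)
    (hpq : ∀ j : ℤ, 0 ≤ j → s ≤ j → j < l → ¬ ((2 * j + 2) * A₂ + 1 ≤ p₂ ∧
      j * A₁ + (2 * j + 3) * a + 1 ≤ q₁ ∧ A₃ - (j + 1) ≤ q₃))
    (hqp : ∀ j : ℤ, 0 ≤ j → s ≤ j → j < l → ¬ ((2 * j + 2) * A₂ + 1 ≤ q₂ ∧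
      j * A₁ + (2 * j + 3) * a + 1 ≤ p₁ ∧ A₃ - (j + 1) ≤ p₃))
    (hw : N₁ * p₁ + N₂ * p₂ + N₃ * p₃ + N₄ * p₄ = N₁ * q₁ + N₂ * q₂ + N₃ * q₃ + N₄ * q₄) :
    p₁ = q₁ ∧ p₂ = q₂ ∧ p₃ = q₃ ∧ p₄ = q₄ := by
  obtain ⟨x, z, h₁, h₂, h₃⟩ := exists_coordinates_of_weight_eq_zero
    (v₁ := p₁ - q₁) (v₂ := p₂ - q₂) (v₃ := p₃ - q₃) (v₄ := p₄ - q₄) hN₁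
    (by rw [hN₁]; positivity) R₁ R₂ R₃ hcop (by linarith)
  have h₁' : q₁ - p₁ = (A₁ + 2 * a) * (-x) + a * (q₄ - p₄) - (A₁ - a - 1) * (-z) := by linarith
  have h₂' : q₂ - p₂ = -2 * A₂ * (-x) - A₂ * (q₄ - p₄) - (-z) := by linarith
  have h₃' : q₃ - p₃ = -(-x) + A₃ * (-z) := by linarith
  have h₄ : p₄ - q₄ = 0 := by
    have := staircase_ne_two hA₂ hA₃ ha hA₁ hp hq h₁ h₂ h₃
    have := staircase_ne_two hA₂ hA₃ ha hA₁ hq hp h₁' h₂' h₃'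
    have := staircase_ne_one hA₂ hA₃ ha hA₁ hsA hp hq h₁ h₂ h₃
    have := staircase_ne_one hA₂ hA₃ ha hA₁ hsA hq hp h₁' h₂' h₃'
    have := hp.f₄
    have := hq.f₄
    have := hp.nonneg
    have := hq.nonneg
    omega
  have h₄' : q₄ - p₄ = 0 := by omega
  rw [h₄, mul_zero] at h₁ h₂
  rw [h₄', mul_zero] at h₁' h₂'
  have hz := staircase_not_neg hA₂ hA₃ ha hlA hp hq hpq
    (by linarith) (by linarith) h₃
  have hz' := staircase_not_neg hA₂ hA₃ ha hlA hq hp hqp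
    (by linarith) (by linarith) h₃'
  obtain rfl : z = 0 := by omega
  have hx := staircase_coord_nonneg hA₂ hp hq (by linarith) (by linarith)
  have hx' := staircase_coord_nonneg (x := -x) hA₂ hq hp (by linarith) (by linarith)
  obtain rfl : x = 0 := by omega
  simp only [mul_zero] at h₁ h₂ h₃
  omega

end Staircase

/-! ### Toric ideals and the criterion by unique standard exponents. -/

section Toric

open MvPolynomial

variable {K : Type*} [Field K]

/-- The weight `∑ nᵢ mᵢ` of an exponent, i.e. the degree of the image of `X ^ m` in `K[t]`. -/
def expWeight (n : Fin 4 → ℕ) (m : Fin 4 →₀ ℕ) : ℕ := ∑ i, n i * m i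

lemma expWeight_add (n : Fin 4 → ℕ) (m m' : Fin 4 →₀ ℕ) :
    expWeight n (m + m') = expWeight n m + expWeight n m' := by
  simp [expWeight, mul_add, Finset.sum_add_distrib]

lemma expWeight_expo (n : Fin 4 → ℕ) (a b c d : ℕ) :
    expWeight n (expo a b c d) = n 0 * a + n 1 * b + n 2 * c + n 3 * d := by
  simp [expWeight, expo, Fin.sum_univ_four]

lemma degree_expo (a b c d : ℕ) : (expo a b c d).degree = a + b + c + d := by
  simp [Finsupp.degree_eq_sum, expo, Fin.sum_univ_four]

lemma expo_le_iff (a b c d : ℕ) (m : Fin 4 →₀ ℕ) :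
    expo a b c d ≤ m ↔ a ≤ m 0 ∧ b ≤ m 1 ∧ c ≤ m 2 ∧ d ≤ m 3 := by
  simp [Finsupp.le_def, Fin.forall_fin_succ, expo]

lemma mon_eq_monomial (a b c d : ℕ) : mon K a b c d = monomial (expo a b c d) 1 := by
  rw [monomial_eq, Finsupp.prod_fintype _ _ (by simp)]
  simp [mon, expo, Fin.prod_univ_four]

lemma aeval_eq_sum (n : Fin 4 → ℕ) (f : MvPolynomial (Fin 4) K) :
    aeval (fun i => (Polynomial.X : Polynomial K) ^ n i) f
      = ∑ m ∈ f.support, Polynomial.monomial (expWeight n m) (coeff m f) := by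
  rw [aeval_def, eval₂_eq']
  refine Finset.sum_congr rfl fun m _ => ?_
  rw [← Polynomial.C_mul_X_pow_eq_monomial]
  simp [expWeight, ← pow_mul, Finset.prod_pow_eq_pow_sum, Polynomial.algebraMap_eq]

lemma aeval_monomial_one (n : Fin 4 → ℕ) (m : Fin 4 →₀ ℕ) :
    aeval (fun i => (Polynomial.X : Polynomial K) ^ n i) (monomial m (1 : K))
      = Polynomial.X ^ expWeight n m := by
  rw [aeval_monomial, Finsupp.prod_fintype _ _ (by simp)]
  simp [expWeight, ← pow_mul, Finset.prod_pow_eq_pow_sum]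

lemma monomial_sub_monomial_mem_toricIdeal {n : Fin 4 → ℕ} {m m' : Fin 4 →₀ ℕ}
    (h : expWeight n m = expWeight n m') :
    monomial m (1 : K) - monomial m' 1 ∈ toricIdeal K n := by
  rw [toricIdeal, RingHom.mem_ker]
  simp only [map_sub, aeval_monomial_one, h, sub_self]

lemma mon_sub_mon_mem_toricIdeal {n : Fin 4 → ℕ} {a b c d a' b' c' d' : ℕ}
    (h : n 0 * a + n 1 * b + n 2 * c + n 3 * d = n 0 * a' + n 1 * b' + n 2 * c' + n 3 * d') :
    mon K a b c d - mon K a' b' c' d' ∈ toricIdeal K n := by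
  rw [mon_eq_monomial, mon_eq_monomial]
  exact monomial_sub_monomial_mem_toricIdeal (by simpa only [expWeight_expo] using h)

/-- In an element of the toric ideal no exponent is alone in its weight. -/
lemma exists_ne_of_mem_toricIdeal {n : Fin 4 → ℕ} {f : MvPolynomial (Fin 4) K}
    (hf : f ∈ toricIdeal K n) {m : Fin 4 →₀ ℕ} (hm : m ∈ f.support) :
    ∃ m' ∈ f.support, m' ≠ m ∧ expWeight n m' = expWeight n m := by
  by_contra! h
  have h0 : aeval (fun i => (Polynomial.X : Polynomial K) ^ n i) f = 0 := hf
  rw [aeval_eq_sum] at h0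
  have hc := congrArg (fun q => Polynomial.coeff q (expWeight n m)) h0
  simp only [Polynomial.finsetSum_coeff, Polynomial.coeff_monomial, Polynomial.coeff_zero] at hc
  rw [Finset.sum_eq_single_of_mem m hm fun m' hm' hne => if_neg (h m' hm' hne), if_pos rfl] at hc
  exact mem_support_iff.mp hm hc

lemma constantCoeff_aeval {n : Fin 4 → ℕ} (hn : ∀ i, 0 < n i) (f : MvPolynomial (Fin 4) K) :
    Polynomial.constantCoeff (aeval (fun i => (Polynomial.X : Polynomial K) ^ n i) f)
      = constantCoeff f := by
  have : (Polynomial.constantCoeff.comp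
      (aeval (fun i => (Polynomial.X : Polynomial K) ^ n i) :
        MvPolynomial (Fin 4) K →ₐ[K] Polynomial K).toRingHom) = constantCoeff := by
    refine ringHom_ext (fun r => ?_) fun i => ?_
    · simp [Polynomial.algebraMap_eq]
    · simp [(hn i).ne]
  exact RingHom.congr_fun this f

/-- The toric ideal is prime and contained in the maximal ideal of the origin, hence contracted
from the local ring. -/
lemma localClosure_toricIdeal {n : Fin 4 → ℕ} (hn : ∀ i, 0 < n i) :
    localClosure (toricIdeal K n) = toricIdeal K n := by
  refine le_antisymm (fun f hf => ?_) Ideal.le_comap_map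
  rw [localClosure, Ideal.mem_comap,
    IsLocalization.algebraMap_mem_map_algebraMap_iff (nonvanishingAtOrigin K)] at hf
  obtain ⟨u, hu, huf⟩ := hf
  have hu0 : constantCoeff u ≠ 0 := nonZeroDivisors.ne_zero hu
  have hprod : aeval (fun i => (Polynomial.X : Polynomial K) ^ n i) (u * f) = 0 := huf
  rw [map_mul] at hprod
  refine (mul_eq_zero.mp hprod).resolve_left fun h => hu0 ?_
  rw [← constantCoeff_aeval hn, h, map_zero]

lemma finite_setOf_expWeight_eq {n : Fin 4 → ℕ} (hn : ∀ i, 0 < n i) (w : ℕ) :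
    {m : Fin 4 →₀ ℕ | expWeight n m = w}.Finite := by
  refine (Set.finite_Iic (Finsupp.equivFunOnFinite.symm fun _ => w)).subset fun m hm i => ?_
  have h1 : n i * m i ≤ expWeight n m :=
    Finset.single_le_sum (f := fun i => n i * m i) (fun _ _ => Nat.zero_le _) (Finset.mem_univ i)
  rw [Set.mem_ofPred_eq] at hm
  rw [hm] at h1
  simpa using (Nat.le_mul_of_pos_left (m i) (hn i)).trans h1

variable {lt : (Fin 4 →₀ ℕ) → (Fin 4 →₀ ℕ) → Prop}

lemma isLeadingExponent_monomial_sub (hlt : IsNegDegreeOrdering lt) {m m' : Fin 4 →₀ ℕ}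
    (h : lt m' m) : IsLeadingExponent lt (monomial m (1 : K) - monomial m' 1) m := by
  have hne : m' ≠ m := fun e => hlt.irrefl m (e ▸ h)
  refine ⟨?_, fun k hk hkm => ?_⟩
  · simp [coeff_monomial, hne]
  · have : k = m' := by
      by_contra hkm'
      simp [coeff_monomial, Ne.symm hkm, Ne.symm hkm'] at hk
    exact this ▸ h

lemma IsLeadingExponent.neg {f : MvPolynomial (Fin 4) K} {m : Fin 4 →₀ ℕ}
    (h : IsLeadingExponent lt f m) : IsLeadingExponent lt (-f) m := by
  simpa only [IsLeadingExponent, support_neg] using h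

/-- `m` is divisible by no leading monomial of an element of `G`. -/
def IsStandardExponent (lt : (Fin 4 →₀ ℕ) → (Fin 4 →₀ ℕ) → Prop)
    (G : Set (MvPolynomial (Fin 4) K)) (m : Fin 4 →₀ ℕ) : Prop :=
  ∀ f ∈ G, ∀ e, IsLeadingExponent lt f e → ¬ e ≤ m

lemma IsStandardExponent.not_le_of_lt {G : Set (MvPolynomial (Fin 4) K)} {m : Fin 4 →₀ ℕ}
    (hm : IsStandardExponent lt G m) (hlt : IsNegDegreeOrdering lt) {a b c d a' b' c' d' : ℕ}
    (hG : mon K a b c d - mon K a' b' c' d' ∈ G)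
    (h : lt (expo a' b' c' d') (expo a b c d)) :
    ¬ (a ≤ m 0 ∧ b ≤ m 1 ∧ c ≤ m 2 ∧ d ≤ m 3) := by
  rw [← expo_le_iff]
  refine hm _ hG _ ?_
  rw [mon_eq_monomial, mon_eq_monomial]
  exact isLeadingExponent_monomial_sub hlt h

lemma IsStandardExponent.not_le_of_gt {G : Set (MvPolynomial (Fin 4) K)} {m : Fin 4 →₀ ℕ}
    (hm : IsStandardExponent lt G m) (hlt : IsNegDegreeOrdering lt) {a b c d a' b' c' d' : ℕ}
    (hG : mon K a b c d - mon K a' b' c' d' ∈ G)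
    (h : lt (expo a b c d) (expo a' b' c' d')) :
    ¬ (a' ≤ m 0 ∧ b' ≤ m 1 ∧ c' ≤ m 2 ∧ d' ≤ m 3) := by
  rw [← expo_le_iff]
  refine hm _ hG _ ?_
  rw [mon_eq_monomial, mon_eq_monomial, ← neg_sub]
  exact (isLeadingExponent_monomial_sub hlt h).neg

/-- If every weight contains at most one standard exponent, then `G` is a standard basis of the
toric ideal. -/
lemma isStandardBasis_of_unique {n : Fin 4 → ℕ} (hn : ∀ i, 0 < n i)
    (hlt : IsNegDegreeOrdering lt) {G : Set (MvPolynomial (Fin 4) K)} (hfin : G.Finite)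
    (hG : G ⊆ (toricIdeal K n : Set (MvPolynomial (Fin 4) K)))
    (huniq : ∀ m m', IsStandardExponent lt G m → IsStandardExponent lt G m' →
      expWeight n m = expWeight n m' → m = m') :
    IsStandardBasis lt (toricIdeal K n) G := by
  refine ⟨hfin, hG, ?_⟩
  rw [localClosure_toricIdeal hn]
  refine le_antisymm (Ideal.span_mono ?_) (Ideal.span_le.mpr ?_)
  · rintro p ⟨f, hf, m, hm⟩
    exact ⟨f, hG hf, m, hm⟩
  rintro p ⟨f, hf, m, hm, rfl⟩
  have hnot : ¬ IsStandardExponent lt G m := by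
    intro hstd
    obtain ⟨m', hm', hne, hw⟩ := exists_ne_of_mem_toricIdeal hf hm.1
    -- A local ordering is not a well-ordering, but each weight contains finitely many exponents.
    -- The smallest one `q` is standard, since otherwise an element of `G` would rewrite it to a
    -- smaller one of the same weight.
    have hwf : {k : Fin 4 →₀ ℕ | expWeight n k = expWeight n m}.WellFoundedOn lt := by
      have : IsStrictOrder (Fin 4 →₀ ℕ) lt :=
        { irrefl := hlt.irrefl, trans := hlt.trans }
      exact (finite_setOf_expWeight_eq hn _).wellFoundedOn
    obtain ⟨⟨q, hq⟩, -, hmin⟩ := WellFounded.has_min hwf Set.univ ⟨⟨m, rfl⟩, trivial⟩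
    rw [Set.mem_ofPred_eq] at hq
    have hmin' : ∀ k, expWeight n k = expWeight n m → ¬ lt k q :=
      fun k hk => hmin ⟨k, hk⟩ trivial
    have hqstd : IsStandardExponent lt G q := by
      rintro g hg e he hle
      obtain ⟨e', he', hne', hw'⟩ := exists_ne_of_mem_toricIdeal (hG hg) he.1
      obtain ⟨c, rfl⟩ := exists_add_of_le hle
      refine hmin' (e' + c) ?_ (hlt.add_right _ _ c (he.2 e' he' hne'))
      rw [← hq, expWeight_add, expWeight_add, hw']
    obtain rfl := huniq q m hqstd hstd hq
    exact hmin' m' hw (hm.2 m' hm' hne)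
  simp only [IsStandardExponent, not_forall, not_not] at hnot
  obtain ⟨g, hg, e, he, hle⟩ := hnot
  obtain ⟨c, rfl⟩ := exists_add_of_le hle
  have : monomial (e + c) (1 : K) = monomial c 1 * monomial e 1 := by
    rw [monomial_mul, one_mul, add_comm]
  rw [this]
  exact Ideal.mul_mem_left _ _ (Ideal.subset_span ⟨g, hg, e, he, rfl⟩)

end Toric
-- Weights, degrees and leading monomials for the given binomials.
section PseudoSymmetric

variable {n : Fin 4 → ℕ} {α₁ α₂ α₃ α₂₁ : ℕ}

lemma IsPseudoSymmetricData.relations (hS : IsPseudoSymmetricData n α₁ α₂ α₃ 3 α₂₁) :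
    n 0 = 2 * α₂ * α₃ + 1 ∧ α₁ * n 0 = n 2 + 2 * n 3 ∧ α₂ * n 1 = α₂₁ * n 0 + n 3 ∧
      α₃ * n 2 = (α₁ - α₂₁ - 1) * n 0 + n 1 := by
  obtain ⟨h₁, h₂, h₃, -, -, ha, e₁, e₂, e₃, e₄⟩ := hS
  obtain ⟨b, rfl⟩ : ∃ b, α₁ = b + 1 + α₂₁ + 1 := ⟨α₁ - α₂₁ - 2, by omega⟩
  obtain ⟨c, rfl⟩ : ∃ c, α₂ = c + 1 := ⟨α₂ - 1, by omega⟩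
  obtain ⟨d, rfl⟩ : ∃ d, α₃ = d + 1 := ⟨α₃ - 1, by omega⟩
  have hb : b + 1 + α₂₁ + 1 - α₂₁ - 1 = b + 1 := by omega
  rw [hb] at e₂ e₃ ⊢
  have e₃' : n 2 = (b + 1 + α₂₁ + 1) * 3 - 3 + (b + 1) * c * 2 + 1 := by
    rw [e₃]
    simp only [Nat.add_sub_cancel]
    omega
  have e₃'' : n 2 = (b + 1 + α₂₁) * 3 + (b + 1) * c * 2 + 1 := by
    rw [e₃']
    omega
  simp only [Nat.add_sub_cancel] at e₁ e₂ e₄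
  rw [e₁, e₂, e₃'', e₄]
  refine ⟨by ring, by ring, by ring, by ring⟩

/-- A common divisor of `n 0` and `n 2` divides `n 1` by the third relation, then `n 3` by the
second. -/
lemma IsPseudoSymmetricData.isCoprime (hS : IsPseudoSymmetricData n α₁ α₂ α₃ 3 α₂₁)
    (hgcd : Finset.univ.gcd n = 1) : IsCoprime (n 0 : ℤ) (n 2 : ℤ) := by
  obtain ⟨-, R₁, R₂, R₃⟩ := hS.relations
  rw [Nat.isCoprime_iff_coprime, Nat.Coprime, ← Nat.dvd_one, ← hgcd]
  have d₀ := Nat.gcd_dvd_left (n 0) (n 2)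
  have d₂ := Nat.gcd_dvd_right (n 0) (n 2)
  have d₁ : (n 0).gcd (n 2) ∣ n 1 :=
    (Nat.dvd_add_right (d₀.mul_left _)).mp (R₃ ▸ d₂.mul_left α₃)
  have d₃ : (n 0).gcd (n 2) ∣ n 3 :=
    (Nat.dvd_add_right (d₀.mul_left _)).mp (R₂ ▸ d₁.mul_left α₂)
  refine Finset.dvd_gcd fun i _ => ?_
  fin_cases i <;> assumption

/-- The weights of the two monomials of `g_i` agree. -/
lemma IsPseudoSymmetricData.weight_gBinomial (hS : IsPseudoSymmetricData n α₁ α₂ α₃ 3 α₂₁)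
    {i : ℕ} (hi : i < α₃) :
    n 0 * 0 + n 1 * ((2 * i + 1) * α₂ + 1) + n 2 * 0 + n 3 * 1 =
      n 0 * (i * α₁ + (2 * i + 2) * α₂₁ + 1) + n 1 * 0 + n 2 * (α₃ - (i + 1)) + n 3 * 0 := by
  obtain ⟨-, R₁, R₂, R₃⟩ := hS.relations
  have ha := hS.α₂₁_lt
  zify [Nat.succ_le_of_lt hi, (by omega : α₂₁ ≤ α₁), (by omega : 1 ≤ α₁ - α₂₁)] at R₁ R₂ R₃ ⊢
  linear_combination -(i + 1) * R₁ + (2 * i + 1) * R₂ - R₃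

/-- The weights of the two monomials of `h_j` agree. -/
lemma IsPseudoSymmetricData.weight_hBinomial (hS : IsPseudoSymmetricData n α₁ α₂ α₃ 3 α₂₁)
    {j : ℕ} (hj : j < α₃) :
    n 0 * 0 + n 1 * ((2 * j + 2) * α₂ + 1) + n 2 * 0 + n 3 * 0 =
      n 0 * (j * α₁ + (2 * j + 3) * α₂₁ + 1) + n 1 * 0 + n 2 * (α₃ - (j + 1)) + n 3 * 0 := by
  have hg := hS.weight_gBinomial hj
  obtain ⟨-, -, R₂, -⟩ := hS.relations
  linarith

/-- All listed binomials lie in the toric ideal. -/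
lemma IsPseudoSymmetricData.basisSet_subset {K : Type*} [Field K] {s l : ℕ}
    (hS : IsPseudoSymmetricData n α₁ α₂ α₃ 3 α₂₁) (hs : s < α₃) (hl : l < α₃) :
    basisSet K α₁ α₂ α₃ 3 α₂₁ s l ⊆ (toricIdeal K n : Set (MvPolynomial (Fin 4) K)) := by
  obtain ⟨-, R₁, R₂, R₃⟩ := hS.relations
  have ha := hS.α₂₁_lt
  have h₁ := hS.one_lt_α₁
  have h₂ := hS.one_lt_α₂
  have h₃ := hS.one_lt_α₃
  rintro f ((hf | ⟨i, hi, rfl⟩) | ⟨j, hj, rfl⟩)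
  · simp only [Set.mem_insert_iff, Set.mem_singleton_iff] at hf
    rcases hf with rfl | rfl | rfl | rfl | rfl | rfl | rfl <;>
      refine mon_sub_mon_mem_toricIdeal ?_ <;>
      zify [h₁.le, h₂.le, h₃.le, (by omega : α₂₁ ≤ α₁), (by omega : 1 ≤ α₁ - α₂₁)] at R₁ R₂ R₃ ⊢
    · linear_combination R₁
    · linear_combination R₂
    · linear_combination R₃
    · linear_combination -R₁ - R₂ - R₃
    · linear_combination R₁ + R₃
    · linear_combination R₁ - R₂
    · linear_combination R₁ - 2 * R₂
  · exact mon_sub_mon_mem_toricIdeal (hS.weight_gBinomial (lt_of_le_of_lt hi hs))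
  · exact mon_sub_mon_mem_toricIdeal (hS.weight_hBinomial (lt_of_le_of_lt hj.2 hl))

/-- The smallest index whose `g` has its pure `X₁`, `X₃` monomial of larger degree is at most
`α₃ - 1`. -/
lemma IsPseudoSymmetricData.lt_of_isLeast_g (hS : IsPseudoSymmetricData n α₁ α₂ α₃ 3 α₂₁)
    (hn : n 0 < n 1 ∧ n 1 < n 2 ∧ n 2 < n 3) {s : ℕ}
    (hs : IsLeast {i : ℕ |
      (2 * i + 1) * α₂ + (i + 2) < i * α₁ + (2 * i + 2) * α₂₁ + α₃} s) : s < α₃ := by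
  have h₃ := hS.one_lt_α₃
  refine lt_of_le_of_lt (hs.2 (?_ : α₃ - 1 ∈ _)) (by omega)
  -- At `i = α₃ - 1` the factor `X₃` disappears: a pure power of `X₁`, the variable of least weight,
  -- has the weight of the other monomial and hence larger degree.
  have hw := hS.weight_gBinomial (i := α₃ - 1) (by omega)
  rw [Set.mem_ofPred_eq]
  simp only [mul_zero, mul_one, zero_add, add_zero,
    show α₃ - (α₃ - 1 + 1) = 0 by omega] at hw
  set i := α₃ - 1 with hi
  have hα : α₃ = i + 1 := by omega
  rw [hα]
  have hlt : n 0 * ((2 * i + 1) * α₂ + 2) < n 0 * (i * α₁ + (2 * i + 2) * α₂₁ + 1) := by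
    rw [← hw]
    nlinarith [Nat.mul_le_mul_right ((2 * i + 1) * α₂ + 1) hn.1.le]
  have := lt_of_mul_lt_mul_left hlt (Nat.zero_le _)
  linarith

/-- The smallest index whose `h` has its pure `X₁`, `X₃` monomial of larger degree is at most
`α₃ - 1`. -/
lemma IsPseudoSymmetricData.lt_of_isLeast_h (hS : IsPseudoSymmetricData n α₁ α₂ α₃ 3 α₂₁)
    (hn : n 0 < n 1 ∧ n 1 < n 2 ∧ n 2 < n 3) {l : ℕ}
    (hl : IsLeast {i : ℕ |
      (2 * i + 2) * α₂ + (i + 1) < i * α₁ + (2 * i + 3) * α₂₁ + α₃} l) : l < α₃ := by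
  have h₃ := hS.one_lt_α₃
  refine lt_of_le_of_lt (hl.2 (?_ : α₃ - 1 ∈ _)) (by omega)
  have hw := hS.weight_hBinomial (j := α₃ - 1) (by omega)
  rw [Set.mem_ofPred_eq]
  simp only [mul_zero, zero_add, add_zero,
    show α₃ - (α₃ - 1 + 1) = 0 by omega] at hw
  set i := α₃ - 1 with hi
  have hα : α₃ = i + 1 := by omega
  rw [hα]
  have hlt : n 0 * ((2 * i + 2) * α₂ + 1) < n 0 * (i * α₁ + (2 * i + 3) * α₂₁ + 1) := by
    rw [← hw]
    exact Nat.mul_lt_mul_of_pos_right hn.1 (by omega)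
  have := lt_of_mul_lt_mul_left hlt (Nat.zero_le _)
  linarith

/-- Degree comparison in `f₁, …, f₇`. -/
lemma IsPseudoSymmetricData.degree_lt (hS : IsPseudoSymmetricData n α₁ α₂ α₃ 3 α₂₁)
    (hn : n 0 < n 1 ∧ n 1 < n 2 ∧ n 2 < n 3) :
    3 < α₁ ∧ α₃ < α₁ - α₂₁ - 1 + 1 ∧ 3 < 1 + (α₂ - 1) + (α₃ - 1) ∧
      3 < α₂₁ + 1 + (α₃ - 1) ∧ α₂ + 2 < α₁ + α₂₁ ∧ 2 * α₂ + 1 < α₁ + 2 * α₂₁ := by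
  obtain ⟨-, R₁, R₂, R₃⟩ := hS.relations
  obtain ⟨h₀₁, h₁₂, h₂₃⟩ := hn
  have ha := hS.α₂₁_lt
  have h₁ := hS.one_lt_α₁
  have h₂ := hS.one_lt_α₂
  have h₃ := hS.one_lt_α₃
  have hpos := hS.α₂₁_pos
  have hβ : ((α₁ - α₂₁ - 1 : ℕ) : ℤ) = α₁ - α₂₁ - 1 := by omega
  zify at R₁ R₂ R₃ h₀₁ h₁₂ h₂₃ h₂ h₃ hpos
  rw [hβ] at R₃
  have p₀ : (0 : ℤ) ≤ n 0 := by positivity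
  generalize (n 0 : ℤ) = N₀, (n 1 : ℤ) = N₁, (n 2 : ℤ) = N₂, (n 3 : ℤ) = N₃ at *
  have t₁ : (3 : ℤ) < α₁ := by
    by_contra! h
    nlinarith
  have t₂ : (α₃ : ℤ) < α₁ - α₂₁ := by
    by_contra! h
    nlinarith
  -- Otherwise `α₂ = α₃ = 2`, and the relation of `f₄` reads `3 n₄ = n₁ + n₂ + n₃`, impossible as
  -- `n₄` is largest.
  have t₃ : (4 : ℤ) < α₂ + α₃ := by
    by_contra! h
    have e₂ : (α₂ : ℤ) = 2 := by omega
    have e₃ : (α₃ : ℤ) = 2 := by omega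
    rw [e₂] at R₂
    rw [e₃] at R₃
    linarith
  -- Otherwise `α₂₁ = 1`, `α₃ = 2`, and the relation of `f₅` reads `2 n₁ + n₃ = n₂ + 2 n₄`.
  have t₄ : (3 : ℤ) < α₂₁ + α₃ := by
    by_contra! h
    have e₂ : (α₂₁ : ℤ) = 1 := by omega
    have e₃ : (α₃ : ℤ) = 2 := by omega
    rw [e₂] at R₂ R₃
    rw [e₃] at R₃
    linarith
  have t₅ : (α₂ : ℤ) + 2 < α₁ + α₂₁ := by
    by_contra! h
    nlinarith
  have t₆ : 2 * (α₂ : ℤ) + 1 < α₁ + 2 * α₂₁ := by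
    by_contra! h
    nlinarith
  omega

/-- A standard exponent is a staircase point. -/
lemma IsPseudoSymmetricData.isStaircasePoint {K : Type*} [Field K] {s l : ℕ}
    (hS : IsPseudoSymmetricData n α₁ α₂ α₃ 3 α₂₁)
    (hn : n 0 < n 1 ∧ n 1 < n 2 ∧ n 2 < n 3) (hα₂ : α₂₁ + 1 < α₂)
    (hs : IsLeast {i : ℕ |
      (2 * i + 1) * α₂ + (i + 2) < i * α₁ + (2 * i + 2) * α₂₁ + α₃} s)
    (hl : IsLeast {i : ℕ |
      (2 * i + 2) * α₂ + (i + 1) < i * α₁ + (2 * i + 3) * α₂₁ + α₃} l)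
    {lt : (Fin 4 →₀ ℕ) → (Fin 4 →₀ ℕ) → Prop} (hlt : IsNegDegreeOrdering lt)
    (htie : ∀ i < s,
      (expo 0 ((2 * i + 1) * α₂ + 1) 0 1).degree
        = (expo (i * α₁ + (2 * i + 2) * α₂₁ + 1) 0 (α₃ - (i + 1)) 0).degree →
      lt (expo 0 ((2 * i + 1) * α₂ + 1) 0 1)
        (expo (i * α₁ + (2 * i + 2) * α₂₁ + 1) 0 (α₃ - (i + 1)) 0))
    {m : Fin 4 →₀ ℕ}
    (hm : IsStandardExponent lt (basisSet K α₁ α₂ α₃ 3 α₂₁ s l) m) :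
    IsStaircasePoint α₁ α₂ α₃ α₂₁ s l (m 0) (m 1) (m 2) (m 3) := by
  have hsα := hS.lt_of_isLeast_g hn hs
  have hlα := hS.lt_of_isLeast_h hn hl
  obtain ⟨t₁, t₂, t₃, t₄, t₅, t₆⟩ := hS.degree_lt hn
  -- Since `α₂ > α₂₁ + 1`, the inequality defining `l` implies the one defining `s`.
  have hsl : s ≤ l := by
    refine hs.2 ?_
    have := hl.1
    rw [Set.mem_ofPred_eq] at this ⊢
    linarith
  have hg : ∀ i ≤ s, gBinomial K α₁ α₂ α₃ α₂₁ i ∈ basisSet K α₁ α₂ α₃ 3 α₂₁ s l :=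
    fun i hi => Or.inl (Or.inr ⟨i, hi, rfl⟩)
  have hh : hBinomial K α₁ α₂ α₃ α₂₁ l ∈ basisSet K α₁ α₂ α₃ 3 α₂₁ s l :=
    Or.inr ⟨l, ⟨hsl, le_rfl⟩, rfl⟩
  have key : ∀ {a b c d a' b' c' d' : ℕ}, a' + b' + c' + d' < a + b + c + d →
      lt (expo a b c d) (expo a' b' c' d') := fun h =>
    hlt.of_degree_lt _ _ (by simpa only [degree_expo] using h)
  have c₁ := hm.not_le_of_gt hlt (a := α₁) (b := 0) (c := 0) (d := 0)
    (a' := 0) (b' := 0) (c' := 1) (d' := 2) (by simp [basisSet]) (key (by omega))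
  have c₂ := hm.not_le_of_gt hlt (a := 0) (b := α₂) (c := 0) (d := 0)
    (a' := α₂₁) (b' := 0) (c' := 0) (d' := 1) (by simp [basisSet]) (key (by omega))
  have c₃ := hm.not_le_of_lt hlt (a := 0) (b := 0) (c := α₃) (d := 0)
    (a' := α₁ - α₂₁ - 1) (b' := 1) (c' := 0) (d' := 0) (by simp [basisSet]) (key (by omega))
  have c₄ := hm.not_le_of_lt hlt (a := 0) (b := 0) (c := 0) (d := 3)
    (a' := 1) (b' := α₂ - 1) (c' := α₃ - 1) (d' := 0) (by simp [basisSet]) (key (by omega))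
  have c₅ := hm.not_le_of_gt hlt (a := α₂₁ + 1) (b := 0) (c := α₃ - 1) (d := 0)
    (a' := 0) (b' := 1) (c' := 0) (d' := 2) (by simp [basisSet]) (key (by omega))
  have c₆ := hm.not_le_of_gt hlt (a := α₁ + α₂₁) (b := 0) (c := 0) (d := 0)
    (a' := 0) (b' := α₂) (c' := 1) (d' := 1) (by simp [basisSet]) (key (by omega))
  have c₇ := hm.not_le_of_gt hlt (a := α₁ + 2 * α₂₁) (b := 0) (c := 0) (d := 0)
    (a' := 0) (b' := 2 * α₂) (c' := 1) (d' := 0) (by simp [basisSet]) (key (by omega))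
  have hs₁ := hs.1
  have hl₁ := hl.1
  rw [Set.mem_ofPred_eq] at hs₁ hl₁
  have cg := hm.not_le_of_lt hlt (hg s le_rfl) (key (by omega))
  have ch := hm.not_le_of_lt hlt hh (key (by omega))
  refine ⟨by omega, by omega, by omega, by omega, by omega, by omega, by omega, by omega,
    ?_, ?_, ?_⟩
  · intro i hi his
    lift i to ℕ using hi
    have his' : i < s := by exact_mod_cast his
    -- Minimality of `s` gives only a weak degree inequality; equality is left to the tie-breaking
    -- rule.
    have hi₁ : ¬ _ := fun h => his'.not_ge (hs.2 h)
    rw [Set.mem_ofPred_eq, not_lt] at hi₁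
    have ci := hm.not_le_of_gt hlt (hg i his'.le) (by
      rcases eq_or_ne ((expo 0 ((2 * i + 1) * α₂ + 1) 0 1).degree)
        (expo (i * α₁ + (2 * i + 2) * α₂₁ + 1) 0 (α₃ - (i + 1)) 0).degree with h | h
      · exact htie i his' h
      · simp only [degree_expo] at h
        exact key (by omega))
    rintro ⟨h₁, h₂⟩
    exact ci ⟨by exact_mod_cast h₁, Nat.zero_le _, by omega, Nat.zero_le _⟩
  · rintro ⟨h₁, h₂⟩
    exact cg ⟨Nat.zero_le _, by exact_mod_cast h₁, Nat.zero_le _, by exact_mod_cast h₂⟩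
  · intro h₁
    exact ch ⟨Nat.zero_le _, by exact_mod_cast h₁, Nat.zero_le _, Nat.zero_le _⟩

/-- Whichever monomial of `h_j` leads, `h_j` excludes one of two standard exponents. -/
lemma hBinomial_not_le {K : Type*} [Field K] {s l : ℕ}
    {lt : (Fin 4 →₀ ℕ) → (Fin 4 →₀ ℕ) → Prop} (hlt : IsNegDegreeOrdering lt)
    {p q : Fin 4 →₀ ℕ}
    (hp : IsStandardExponent lt (basisSet K α₁ α₂ α₃ 3 α₂₁ s l) p)
    (hq : IsStandardExponent lt (basisSet K α₁ α₂ α₃ 3 α₂₁ s l) q) :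
    ∀ j : ℤ, 0 ≤ j → s ≤ j → j < l → ¬ ((2 * j + 2) * α₂ + 1 ≤ (p 1 : ℤ) ∧
      j * α₁ + (2 * j + 3) * α₂₁ + 1 ≤ (q 0 : ℤ) ∧ α₃ - (j + 1) ≤ (q 2 : ℤ)) := by
  rintro j hj hsj hjl ⟨h₁, h₂, h₃⟩
  lift j to ℕ using hj
  have hmem : hBinomial K α₁ α₂ α₃ α₂₁ j ∈ basisSet K α₁ α₂ α₃ 3 α₂₁ s l :=
    Or.inr ⟨j, ⟨by exact_mod_cast hsj, by omega⟩, rfl⟩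
  -- For `s ≤ j < l` the degrees may tie with no rule to break it, so either monomial may lead: one
  -- excludes `p`, the other `q`.
  rcases hlt.total (expo 0 ((2 * j + 2) * α₂ + 1) 0 0)
    (expo (j * α₁ + (2 * j + 3) * α₂₁ + 1) 0 (α₃ - (j + 1)) 0) with h | h | h
  · exact hq.not_le_of_gt hlt hmem h
      ⟨by exact_mod_cast h₂, Nat.zero_le _, by omega, Nat.zero_le _⟩
  · have := DFunLike.congr_fun h 1
    simp [expo] at this
  · exact hp.not_le_of_lt hlt hmem h
      ⟨Nat.zero_le _, by exact_mod_cast h₁, Nat.zero_le _, Nat.zero_le _⟩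

end PseudoSymmetric

theorem mainTheorem1 {K : Type*} [Field K] (n : Fin 4 → ℕ) (α₁ α₂ α₃ α₄ α₂₁ s l : ℕ)
    (hS : IsPseudoSymmetricData n α₁ α₂ α₃ α₄ α₂₁)
    (hgcd : Finset.univ.gcd n = 1)
    (hα₄ : α₄ = 3)
    (hn : n 0 < n 1 ∧ n 1 < n 2 ∧ n 2 < n 3)
    (hα₂ : α₂₁ + 1 < α₂)
    (hs : IsLeast {i : ℕ |
      (2 * i + 1) * α₂ + (i + 2) < i * α₁ + (2 * i + 2) * α₂₁ + α₃} s)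
    (hl : IsLeast {i : ℕ |
      (2 * i + 2) * α₂ + (i + 1) < i * α₁ + (2 * i + 3) * α₂₁ + α₃} l)
    (lt : (Fin 4 →₀ ℕ) → (Fin 4 →₀ ℕ) → Prop) (hlt : IsNegDegreeOrdering lt)
    -- tie-breaking: only relevant if the two monomials of some `g_i` have the same degree
    (htie : ∀ i < s,
      (expo 0 ((2 * i + 1) * α₂ + 1) 0 1).degree
        = (expo (i * α₁ + (2 * i + 2) * α₂₁ + 1) 0 (α₃ - (i + 1)) 0).degree →
      lt (expo 0 ((2 * i + 1) * α₂ + 1) 0 1)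
        (expo (i * α₁ + (2 * i + 2) * α₂₁ + 1) 0 (α₃ - (i + 1)) 0)) :
    IsStandardBasis lt (toricIdeal K n) (basisSet K α₁ α₂ α₃ α₄ α₂₁ s l) := by
  subst hα₄
  have hsα := hS.lt_of_isLeast_g hn hs
  have hlα := hS.lt_of_isLeast_h hn hl
  have hn₀ : 0 < n 0 := by rw [hS.n₁_eq]; omega
  have hfin : (basisSet K α₁ α₂ α₃ 3 α₂₁ s l).Finite :=
    ((Set.toFinite _).union ((Set.finite_Iic s).image _)).union ((Set.finite_Icc s l).image _)
  refine isStandardBasis_of_unique (fun i => by fin_cases i <;> simp <;> omega) hlt hfin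
    (hS.basisSet_subset hsα hlα) fun p q hp hq hw => ?_
  obtain ⟨hN₁, R₁, R₂, R₃⟩ := hS.relations
  have ha := hS.α₂₁_lt
  have h₂ := hS.one_lt_α₂
  have h₃ := hS.one_lt_α₃
  have hpos := hS.α₂₁_pos
  simp only [expWeight, Fin.sum_univ_four] at hw
  zify [(by omega : α₂₁ ≤ α₁), (by omega : 1 ≤ α₁ - α₂₁)] at hN₁ R₁ R₂ R₃ hw
  obtain ⟨e₀, e₁, e₂, e₃⟩ := staircase_unique (by omega) (by omega) (by omega) (by omega)
    (by omega) (by omega) hN₁ R₁ R₂ R₃ (hS.isCoprime hgcd)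
    (hS.isStaircasePoint hn hα₂ hs hl hlt htie hp) (hS.isStaircasePoint hn hα₂ hs hl hlt htie hq)
    (hBinomial_not_le hlt hp hq) (hBinomial_not_le hlt hq hp) hw
  ext i
  fin_cases i
  · exact_mod_cast e₀
  · exact_mod_cast e₁
  · exact_mod_cast e₂
  · exact_mod_cast e₃
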